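/- Let $X$ be a complex Banach space and let $E$ be a strongly countably additive spectral measure on the Borel sets of $\mathbb C$ with values in the bounded projections of $X$: $E(\mathbb C)=I$, $E(\delta\cap\delta')=E(\delta)E(\delta')$, and $\delta\mapsto E(\delta)x$ is countably additive for each $x\in X$. For a Borel function $F:\mathbb C\to\mathbb C$ let $\int F\,dE$ be the operator $x\mapsto\lim_{n\to\infty}\int_{\{|F|\le n\}}F\,dE\,x$, defined for those $x\in X$ for which the limit exists; here the integral of a bounded Borel function is the limit in operator norm of the integrals of simple functions converging to it uniformly. Let $A$ be a (bounded or unbounded) scalar type spectral operator in $X$ with spectral measure $E$, that is, $A=\int\lambda\,dE(\lambda)$, with equality of domains. Write $e^{tA}:=\int_{\sigma(A)}e^{t\lambda}\,dE(\lambda)$ for $t\ge 0$, and $C^\infty(A):=\bigcap_{n\ge 0}D(A^n)$. Then: 1. $A$ is not hypercyclic: no nonzero $f\in C^\infty(A)$ has an orbit $\{A^nf\}_{n\ge0}$ that is dense in $X$. Moreover, for each nonzero $f\in C^\infty(A)$, either $\inf_{n\ge0}\|A^nf\|>0$ or $\sup_{n\ge0}\|A^nf\|<\infty$. 2. The family $\{e^{tA}\}_{t\ge0}$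 is not hypercyclic: no nonzero $f\in\bigcap_{t\ge0}D(e^{tA})$ has an orbit $\{e^{tA}f\}_{t\ge0}$ that is dense in $X$. Moreover, for each nonzero such $f$, either $\inf_{t\ge0}\|e^{tA}f\|>0$ or $\sup_{t\ge0}\|e^{tA}f\|<\infty$. 3. If $\sigma(A)\subseteq\{\lambda\in\mathbb C:\operatorname{Re}\lambda\le\omega\}$ for some $\omega\in\mathbb R$, then the operators $e^{tA}$, $t\ge0$, are bounded and defined on all of $X$, and $\{e^{tA}\}_{t\ge0}$ is the $C_0$-semigroup whose generator is $A$. -/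

import Mathlib

open Filter Topology MeasureTheory
open scoped NNReal

noncomputable section

namespace ScalarSpectral

variable {X : Type*} [NormedAddCommGroup X] [NormedSpace ℂ X]

/-! ### Partially defined operators -/

/-- The composition `B ∘ A` of two partially defined operators, with its natural domain
`{x ∈ D(A) | A x ∈ D(B)}`. -/
def opComp (B A : X →ₗ.[ℂ] X) : X →ₗ.[ℂ] X where
  domain :=
    { carrier := {x | ∃ h : x ∈ A.domain, A ⟨x, h⟩ ∈ B.domain}
      zero_mem' := ⟨A.domain.zero_mem, by
        have h : A ⟨0, A.domain.zero_mem⟩ = 0 := A.map_zero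
        rw [h]; exact B.domain.zero_mem⟩
      add_mem' := by
        rintro x y ⟨hx, hx'⟩ ⟨hy, hy'⟩
        refine ⟨A.domain.add_mem hx hy, ?_⟩
        have := A.map_add ⟨x, hx⟩ ⟨y, hy⟩
        exact this ▸ B.domain.add_mem hx' hy'
      smul_mem' := by
        rintro c x ⟨hx, hx'⟩
        refine ⟨A.domain.smul_mem c hx, ?_⟩
        have := A.map_smul c ⟨x, hx⟩
        exact this ▸ B.domain.smul_mem c hx' }
  toFun :=
    { toFun := fun x => B ⟨A ⟨x.1, x.2.1⟩, x.2.2⟩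
      map_add' := fun x y => by
        rw [← B.map_add]
        exact congrArg B (Subtype.ext (A.map_add ⟨x.1, x.2.1⟩ ⟨y.1, y.2.1⟩))
      map_smul' := fun c x => by
        rw [RingHom.id_apply, ← B.map_smul]
        exact congrArg B (Subtype.ext (A.map_smul c ⟨x.1, x.2.1⟩)) }

/-- The powers `A ^ n` of a partially defined operator: `A ^ 0 = I` is defined on all of `X`, and
`A ^ (n + 1) = A ∘ A ^ n` has its natural domain. -/
def opPow (A : X →ₗ.[ℂ] X) : ℕ → (X →ₗ.[ℂ] X)
  | 0 => (LinearMap.id : X →ₗ[ℂ] X).toPMap ⊤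
  | n + 1 => opComp A (opPow A n)

/-- The point `z` belongs to the resolvent set of `A` when `A - z I : D(A) → X` is a bijection
with a bounded inverse `R`. The spectrum is the complement of the resolvent set. -/
def opSpectrum (A : X →ₗ.[ℂ] X) : Set ℂ :=
  {z | ∃ R : X →L[ℂ] X,
    (∀ y : X, ∃ h : R y ∈ A.domain, A ⟨R y, h⟩ - z • R y = y) ∧
    ∀ x : A.domain, R (A x - z • (x : X)) = x}ᶜ

/-- The pointwise limit of a family of linear operators along a filter, defined on all the vectors
for which the limit exists. -/
def strongLimit {ι : Type*} (l : Filter ι) [l.NeBot] (T : ι → X →L[ℂ] X) : X →ₗ.[ℂ] X where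
  domain :=
    { carrier := {x | ∃ y, Tendsto (fun i => T i x) l (𝓝 y)}
      zero_mem' := ⟨0, by simp⟩
      add_mem' := by
        rintro a b ⟨y, hy⟩ ⟨z, hz⟩
        exact ⟨y + z, by simpa using hy.add hz⟩
      smul_mem' := by
        rintro c a ⟨y, hy⟩
        exact ⟨c • y, by simpa using hy.const_smul c⟩ }
  toFun :=
    { toFun := fun x => x.2.choose
      map_add' := fun x y => by
        refine tendsto_nhds_unique (x + y).2.choose_spec ?_
        simpa using x.2.choose_spec.add y.2.choose_spec
      map_smul' := fun c x => by
        refine tendsto_nhds_unique (c • x).2.choose_spec ?_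
        simpa using x.2.choose_spec.const_smul c }

/-! ### Hypercyclicity -/

/-- A vector is hypercyclic for a family of partially defined operators when it is nonzero, belongs
to all the domains, and has a dense orbit. -/
def IsHypercyclicVector {J : Type*} (T : J → X →ₗ.[ℂ] X) (f : X) : Prop :=
  f ≠ 0 ∧ ∃ h : ∀ j, f ∈ (T j).domain, Dense (Set.range fun j => T j ⟨f, h j⟩)

/-- A family of partially defined operators is hypercyclic when it has a hypercyclic vector. -/
def IsHypercyclicFamily {J : Type*} (T : J → X →ₗ.[ℂ] X) : Prop :=
  ∃ f, IsHypercyclicVector T f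

/-- An operator `A` is hypercyclic when some nonzero vector in `⋂ n, D(A ^ n)` has a dense orbit
`{A ^ n f | n = 0, 1, 2, …}`. -/
def IsHypercyclic (A : X →ₗ.[ℂ] X) : Prop :=
  IsHypercyclicFamily (opPow A)

/-! ### Strongly continuous semigroups -/

variable (X) in
/-- A `C₀`-semigroup of bounded linear operators. -/
structure C0Semigroup where
  /-- The operators of the semigroup. -/
  op : ℝ≥0 → X →L[ℂ] X
  op_zero : op 0 = 1
  op_add : ∀ s t, op (s + t) = op s * op t
  continuous_orbit : ∀ x, Continuous fun t => op t x

/-- The generator of a semigroup: `x ↦ lim (T(t) x - x) / t` as `t → 0+`, on all the vectors for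
which this limit exists. -/
def C0Semigroup.generator (T : C0Semigroup X) : X →ₗ.[ℂ] X :=
  strongLimit (𝓝[>] (0 : ℝ≥0)) fun t => (((t : ℝ) : ℂ)⁻¹) • (T.op t - 1)

/-! ### Spectral measures and the Borel operational calculus -/

variable (X) in
/-- A strongly countably additive spectral measure on the Borel sets of the complex plane. The
values on sets which are not Borel play no role. Each `E δ` with `δ` Borel is a projection, by
`map_inter` with both sets equal to `δ`. -/
structure SpectralMeasure where
  /-- The projection that belongs to a Borel set. -/
  proj : Set ℂ → X →L[ℂ] X
  map_empty : proj ∅ = 0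
  map_univ : proj Set.univ = 1
  map_inter : ∀ s t, MeasurableSet s → MeasurableSet t → proj (s ∩ t) = proj s * proj t
  hasSum_iUnion : ∀ s : ℕ → Set ℂ, (∀ n, MeasurableSet (s n)) → Pairwise (Function.onFun Disjoint s) →
    ∀ x, HasSum (fun n => proj (s n) x) (proj (⋃ n, s n) x)

namespace SpectralMeasure

variable (E : SpectralMeasure X)

/-- The integral of a simple Borel function. -/
def simpleIntegral (s : SimpleFunc ℂ ℂ) : X →L[ℂ] X :=
  ∑ c ∈ s.range, c • E.proj (s ⁻¹' {c})

/-- The integral of a bounded Borel function `F`: the limit in operator norm of the integrals of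
simple Borel functions that converge uniformly to `F`. -/
def boundedIntegral (F : ℂ → ℂ) : X →L[ℂ] X :=
  limUnder (comap (fun s : SimpleFunc ℂ ℂ => UniformFun.ofFun (s : ℂ → ℂ))
    (𝓝 (UniformFun.ofFun F))) E.simpleIntegral

/-- The (generally unbounded) operator `∫ F dE` for a Borel function `F`: it sends `x` to the limit
of `∫ Fₙ dE x`, where `Fₙ = F` on `{|F| ≤ n}` and `Fₙ = 0` elsewhere, and its domain consists of all
`x` for which this limit exists. -/
def integral (F : ℂ → ℂ) : X →ₗ.[ℂ] X :=
  strongLimit atTop fun n : ℕ => E.boundedIntegral ({z | ‖F z‖ ≤ n}.indicator F)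

end SpectralMeasure

/-- `A` is a scalar type spectral operator with spectral measure (resolution of the identity) `E`:
`A = ∫ z dE(z)`, with equality of domains. -/
def IsScalarTypeSpectral (A : X →ₗ.[ℂ] X) (E : SpectralMeasure X) : Prop :=
  A = E.integral fun z => z

/-- The Borel operational calculus `F(A) = ∫ F dE` over the spectrum of `A`. -/
def funCalc (A : X →ₗ.[ℂ] X) (E : SpectralMeasure X) (F : ℂ → ℂ) : X →ₗ.[ℂ] X :=
  E.integral ((opSpectrum A).indicator F)

/-- The exponential `e ^ (t A)`. -/
def opExp (A : X →ₗ.[ℂ] X) (E : SpectralMeasure X) (t : ℝ) : X →ₗ.[ℂ] X :=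
  funCalc A E fun z => Complex.exp (t * z)

end ScalarSpectral

end

open Filter Topology MeasureTheory
open scoped NNReal

noncomputable section

namespace ScalarSpectral

/-! There is one constant M, depending only on `E`, with ‖∫ F dE‖ ≤ M sup |F| for bounded Borel F.
It comes from finiteness of the variation of each φ(E(·)x) together with uniform boundedness
(`exists_norm_simpleIntegral_le`).

The dichotomy (`norm_integral_dichotomy`) concerns functions F_j with |F_j| ≥ 1 on s and |F_j| ≤ 1
off s. If E(s)f = 0, only values off s count, and ‖∫ F_j dE f‖ ≤ M‖f‖. Otherwise 1/F_j is bounded by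
1 on s and recovers E(s)f from ∫ F_j dE f, so ‖E(s)f‖ ≤ M‖∫ F_j dE f‖. Powers use s = {|z| > 1};
exponentials use the part of the spectrum in Re z > 0. Neither kind of orbit can be dense.

For the semigroup, `E` is carried by the spectrum (`proj_opSpectrum`), so the calculus over σ(A)
loses nothing. The difference quotient of e^{tz} is ψ(tz)z with ψ(w) = (e^w - 1)/w, which is bounded
on the half-plane uniformly in t ≤ 1. Bounded convergence then identifies the generator. -/

variable {X : Type*} [NormedAddCommGroup X] [NormedSpace ℂ X]

/-! ### Scalar measures, uniform boundedness, uniform approximation -/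

/-- A complex-valued vector measure is dominated by a finite measure. -/
theorem exists_isFiniteMeasure_norm_le (v : VectorMeasure ℂ ℂ) :
    ∃ ν : Measure ℂ, IsFiniteMeasure ν ∧ ∀ s, MeasurableSet s → ‖v s‖ ≤ ν.real s := by
  have key (w : SignedMeasure ℂ) :
      ∃ ν : Measure ℂ, IsFiniteMeasure ν ∧ ∀ s, MeasurableSet s → |w s| ≤ ν.real s := by
    refine ⟨w.toJordanDecomposition.posPart + w.toJordanDecomposition.negPart, inferInstance,
      fun s hs => ?_⟩
    have h : w s = w.toJordanDecomposition.posPart.real s -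
        w.toJordanDecomposition.negPart.real s := by
      conv_lhs => rw [← w.toSignedMeasure_toJordanDecomposition]
      simp [JordanDecomposition.toSignedMeasure, Measure.toSignedMeasure_apply_measurable hs]
    rw [h, measureReal_add_apply]
    refine (abs_sub _ _).trans ?_
    simp [abs_of_nonneg]
  obtain ⟨ν₁, h₁, hν₁⟩ := key (v.mapRange Complex.reAddGroupHom Complex.continuous_re)
  obtain ⟨ν₂, h₂, hν₂⟩ := key (v.mapRange Complex.imAddGroupHom Complex.continuous_im)
  refine ⟨ν₁ + ν₂, inferInstance, fun s hs => ?_⟩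
  rw [measureReal_add_apply]
  exact (Complex.norm_le_abs_re_add_abs_im _).trans (add_le_add (hν₁ s hs) (hν₂ s hs))

/-- Weakly bounded families of operators on a Banach space are uniformly bounded. -/
theorem exists_norm_le_of_weakly_bounded [CompleteSpace X] {ι : Type*} (T : ι → X →L[ℂ] X)
    (h : ∀ (x : X) (φ : StrongDual ℂ X), ∃ C, ∀ i, ‖φ (T i x)‖ ≤ C) : ∃ C, ∀ i, ‖T i‖ ≤ C := by
  -- Uniform boundedness is used twice: for the operators, and for the vectors `T i x` seen in the
  -- bidual.
  refine banach_steinhaus fun x => ?_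
  obtain ⟨C, hC⟩ := banach_steinhaus (g := fun i => NormedSpace.inclusionInDoubleDual ℂ X (T i x))
    (h x)
  refine ⟨C, fun i => ?_⟩
  rw [← (NormedSpace.inclusionInDoubleDualLi ℂ (E := X)).norm_map (T i x)]
  exact hC i

/-- A bounded complex function is a uniform limit of simple functions if it is measurable. -/
theorem exists_simpleFunc_norm_sub_lt {F : ℂ → ℂ} (hF : Measurable F) {C : ℝ}
    (hC : ∀ z, ‖F z‖ ≤ C) {ε : ℝ} (hε : 0 < ε) : ∃ s : SimpleFunc ℂ ℂ, ∀ z, ‖s z - F z‖ < ε := by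
  have hcover : Metric.closedBall (0 : ℂ) C ⊆
      ⋃ n, Metric.ball (TopologicalSpace.denseSeq ℂ n) ε := fun z _ => by
    obtain ⟨n, hn⟩ := (TopologicalSpace.denseRange_denseSeq ℂ).exists_dist_lt z hε
    exact Set.mem_iUnion.2 ⟨n, hn⟩
  obtain ⟨t, ht⟩ := (isCompact_closedBall (0 : ℂ) C).elim_finite_subcover _
    (fun n => Metric.isOpen_ball) hcover
  -- `t.sup id` is the largest index in the finite subcover, so the nearest point is sought among a
  -- set containing an ε-net of the ball.
  refine ⟨(SimpleFunc.nearestPt (TopologicalSpace.denseSeq ℂ) (t.sup id)).comp F hF, fun z => ?_⟩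
  obtain ⟨n, hn, hzn⟩ := Set.mem_iUnion₂.1 (ht (mem_closedBall_zero_iff.2 (hC z)))
  have h := SimpleFunc.edist_nearestPt_le (TopologicalSpace.denseSeq ℂ) (F z)
    (Finset.le_sup (f := id) hn)
  rw [edist_dist, edist_dist, ENNReal.ofReal_le_ofReal_iff dist_nonneg] at h
  rw [← dist_eq_norm]
  exact h.trans_lt (Metric.mem_ball'.1 hzn)

/-! ### Integrals of simple functions -/

namespace SpectralMeasure

variable (E : SpectralMeasure X)

open scoped Classical in
/-- The vector measure `δ ↦ E δ x`. -/
def vectorMeasure (x : X) : VectorMeasure ℂ X where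
  measureOf' s := if MeasurableSet s then E.proj s x else 0
  empty' := by simp [E.map_empty]
  not_measurable' s hs := if_neg hs
  m_iUnion' s hs hd := by
    simp only [hs, MeasurableSet.iUnion hs, if_true]
    exact E.hasSum_iUnion s hs hd x

variable {E} in
theorem vectorMeasure_apply {s : Set ℂ} (hs : MeasurableSet s) (x : X) :
    E.vectorMeasure x s = E.proj s x := if_pos hs

theorem tendsto_proj_iUnion {s : ℕ → Set ℂ} (hm : Monotone s) (hs : ∀ n, MeasurableSet (s n))
    (x : X) : Tendsto (fun n => E.proj (s n) x) atTop (𝓝 (E.proj (⋃ n, s n) x)) := by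
  have h := (E.vectorMeasure x).tendsto_vectorMeasure_iUnion_atTop_nat hm hs
  simpa only [vectorMeasure_apply (hs _), vectorMeasure_apply (.iUnion hs)] using h

theorem proj_union {s t : Set ℂ} (hs : MeasurableSet s) (ht : MeasurableSet t)
    (hd : Disjoint s t) : E.proj (s ∪ t) = E.proj s + E.proj t := by
  ext x
  have h := (E.vectorMeasure x).of_union hd hs ht
  rwa [vectorMeasure_apply hs, vectorMeasure_apply ht, vectorMeasure_apply (hs.union ht)] at h

theorem proj_iUnion_eq_zero {s : ℕ → Set ℂ} (hs : ∀ n, MeasurableSet (s n))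
    (h0 : ∀ n, E.proj (s n) = 0) : E.proj (⋃ n, s n) = 0 := by
  ext x
  have hd n : MeasurableSet (disjointed s n) := .disjointed (fun n => hs n) n
  have h := E.hasSum_iUnion (disjointed s) hd (disjoint_disjointed s) x
  rw [iUnion_disjointed] at h
  have h1 n : E.proj (disjointed s n) = 0 := by
    rw [← Set.inter_eq_left.2 (disjointed_le s n), E.map_inter _ _ (hd n) (hs n), h0, mul_zero]
  simpa [h1] using (h.unique (by simp [h1] : HasSum _ (0 : X)))

theorem proj_preimage_finset {β : Type*} (p : SimpleFunc ℂ β) (S : Finset β) :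
    E.proj (p ⁻¹' S) = ∑ b ∈ S, E.proj (p ⁻¹' {b}) := by
  classical
  induction S using Finset.induction_on with
  | empty => simp [E.map_empty]
  | insert b S hb ih =>
    rw [Finset.sum_insert hb, ← ih, Finset.coe_insert, Set.insert_eq, Set.preimage_union,
      E.proj_union (p.measurableSet_preimage _) (p.measurableSet_preimage _)]
    exact Disjoint.preimage _ (by simpa using hb)

/-- The integral may be computed on any partition refining the level sets. Applied to `s.pair t`,
this puts two simple functions on a common partition. -/
theorem simpleIntegral_map {β : Type*} (p : SimpleFunc ℂ β) (g : β → ℂ) :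
    E.simpleIntegral (p.map g) = ∑ b ∈ p.range, g b • E.proj (p ⁻¹' {b}) := by
  classical
  rw [simpleIntegral, SimpleFunc.range_map]
  refine Finset.sum_image' _ fun b _ => ?_
  rw [SimpleFunc.map_preimage_singleton, proj_preimage_finset, Finset.smul_sum]
  refine Finset.sum_congr rfl fun c hc => ?_
  rw [(Finset.mem_filter.1 hc).2]

theorem simpleIntegral_add (s t : SimpleFunc ℂ ℂ) :
    E.simpleIntegral (s + t) = E.simpleIntegral s + E.simpleIntegral t := by
  have hs := E.simpleIntegral_map (s.pair t) Prod.fst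
  have ht := E.simpleIntegral_map (s.pair t) Prod.snd
  have hst := E.simpleIntegral_map (s.pair t) fun p => p.1 + p.2
  simp only [add_smul, Finset.sum_add_distrib] at hst
  rw [← hs, ← ht] at hst
  exact hst

theorem simpleIntegral_mul (s t : SimpleFunc ℂ ℂ) :
    E.simpleIntegral (s * t) = E.simpleIntegral s * E.simpleIntegral t := by
  have hs := E.simpleIntegral_map (s.pair t) Prod.fst
  have ht := E.simpleIntegral_map (s.pair t) Prod.snd
  have hst := E.simpleIntegral_map (s.pair t) fun p => p.1 * p.2
  change E.simpleIntegral s = _ at hs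
  change E.simpleIntegral t = _ at ht
  change E.simpleIntegral (s * t) = _ at hst
  rw [hs, ht, hst, Finset.sum_mul_sum]
  refine Finset.sum_congr rfl fun p hp => ?_
  -- Fibres over distinct points are disjoint, so their projections multiply to zero and only the
  -- diagonal survives.
  rw [Finset.sum_eq_single p]
  · rw [smul_mul_smul_comm, ← E.map_inter _ _ (SimpleFunc.measurableSet_preimage _ _)
      (SimpleFunc.measurableSet_preimage _ _), Set.inter_self]
  · intro q _ hq
    rw [smul_mul_smul_comm, ← E.map_inter _ _ (SimpleFunc.measurableSet_preimage _ _)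
      (SimpleFunc.measurableSet_preimage _ _), ← Set.preimage_inter,
      Set.singleton_inter_eq_empty.2 (by simpa using hq.symm), Set.preimage_empty, E.map_empty,
      smul_zero]
  · exact fun h => absurd hp h

theorem simpleIntegral_smul (c : ℂ) (s : SimpleFunc ℂ ℂ) :
    E.simpleIntegral (c • s) = c • E.simpleIntegral s := by
  have h := E.simpleIntegral_map s fun z => c • z
  simp only [smul_assoc, ← Finset.smul_sum] at h
  exact h

/-- The scalar measure φ(E(·)x) is dominated by a finite measure, whose total mass serves as `M`.
The dependence on `x` and `φ` is removed afterwards by uniform boundedness. -/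
theorem exists_norm_apply_simpleIntegral_le (x : X) (φ : StrongDual ℂ X) :
    ∃ M, ∀ (s : SimpleFunc ℂ ℂ) (C : ℝ), (∀ z, ‖s z‖ ≤ C) →
      ‖φ (E.simpleIntegral s x)‖ ≤ C * M := by
  obtain ⟨ν, hν, h⟩ := exists_isFiniteMeasure_norm_le
    ((E.vectorMeasure x).mapRange (φ : X →ₗ[ℂ] ℂ).toAddMonoidHom φ.continuous)
  refine ⟨ν.real Set.univ, fun s C hC => ?_⟩
  have h1 c : ‖φ (E.proj (s ⁻¹' {c}) x)‖ ≤ ν.real (s ⁻¹' {c}) := by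
    rw [← vectorMeasure_apply (s.measurableSet_preimage {c})]
    exact h _ (s.measurableSet_preimage {c})
  have h2 : ∑ c ∈ s.range, ν.real (s ⁻¹' {c}) = ν.real Set.univ := by
    rw [sum_measureReal_preimage_singleton _ fun c _ => s.measurableSet_preimage {c},
      SimpleFunc.coe_range, Set.preimage_range]
  rw [simpleIntegral, sum_apply, map_sum, ← h2, Finset.mul_sum]
  refine (norm_sum_le _ _).trans (Finset.sum_le_sum fun c hc => ?_)
  obtain ⟨z, rfl⟩ := SimpleFunc.mem_range.1 hc
  rw [smul_apply, map_smul, norm_smul]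
  exact mul_le_mul (hC z) (h1 _) (norm_nonneg _) ((norm_nonneg _).trans (hC z))

theorem exists_norm_simpleIntegral_le [CompleteSpace X] :
    ∃ M, 0 ≤ M ∧ ∀ (s : SimpleFunc ℂ ℂ) (C : ℝ), (∀ z, ‖s z‖ ≤ C) →
      ‖E.simpleIntegral s‖ ≤ M * C := by
  obtain ⟨M, hM⟩ := exists_norm_le_of_weakly_bounded
    (fun s : {s : SimpleFunc ℂ ℂ // ∀ z, ‖s z‖ ≤ 1} => E.simpleIntegral s) fun x φ => by
      obtain ⟨M, hM⟩ := E.exists_norm_apply_simpleIntegral_le x φ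
      exact ⟨1 * M, fun s => hM s 1 s.2⟩
  have hM0 : 0 ≤ M := (norm_nonneg _).trans (hM ⟨0, fun z => by simp⟩)
  refine ⟨M, hM0, fun s C hC => ?_⟩
  have hC0 : 0 ≤ C := (norm_nonneg _).trans (hC 0)
  rcases hC0.eq_or_lt with rfl | hpos
  · have : E.simpleIntegral s = 0 := Finset.sum_eq_zero fun c hc => by
      obtain ⟨z, rfl⟩ := SimpleFunc.mem_range.1 hc
      rw [norm_le_zero_iff.1 (hC z), zero_smul]
    simp [this]
  · have h := hM ⟨((C : ℂ)⁻¹) • s, fun z => by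
      rw [SimpleFunc.smul_apply, norm_smul, norm_inv, Complex.norm_of_nonneg hC0,
        inv_mul_le_one₀ hpos]
      exact hC z⟩
    rw [simpleIntegral_smul, norm_smul, norm_inv, Complex.norm_of_nonneg hC0,
      inv_mul_le_iff₀ hpos] at h
    linarith

section Complete

variable [CompleteSpace X]

/-- A constant `M` with `‖∫ F dE‖ ≤ M * sup |F|` for bounded Borel functions. -/
def normBound : ℝ := E.exists_norm_simpleIntegral_le.choose

theorem normBound_nonneg : 0 ≤ E.normBound := E.exists_norm_simpleIntegral_le.choose_spec.1

theorem norm_simpleIntegral_le (s : SimpleFunc ℂ ℂ) {C : ℝ} (hC : ∀ z, ‖s z‖ ≤ C) :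
    ‖E.simpleIntegral s‖ ≤ E.normBound * C :=
  E.exists_norm_simpleIntegral_le.choose_spec.2 s C hC

theorem norm_simpleIntegral_sub_le (s t : SimpleFunc ℂ ℂ) {C : ℝ} (hC : ∀ z, ‖s z - t z‖ ≤ C) :
    ‖E.simpleIntegral s - E.simpleIntegral t‖ ≤ E.normBound * C := by
  have h := E.simpleIntegral_add s ((-1 : ℂ) • t)
  rw [simpleIntegral_smul, neg_one_smul ℂ (E.simpleIntegral t), ← sub_eq_add_neg] at h
  rw [← h]
  refine E.norm_simpleIntegral_le _ fun z => ?_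
  simpa [← sub_eq_add_neg] using hC z

end Complete

end SpectralMeasure

/-! ### Bounded Borel functions and their integrals -/

/-- Bounded Borel functions. -/
def IsBoundedBorel (F : ℂ → ℂ) : Prop := Measurable F ∧ ∃ C : ℝ, ∀ z, ‖F z‖ ≤ C

theorem IsBoundedBorel.exists_seq_tendstoUniformly {F : ℂ → ℂ} (hF : IsBoundedBorel F) :
    ∃ s : ℕ → SimpleFunc ℂ ℂ, TendstoUniformly (fun n => (s n : ℂ → ℂ)) F atTop := by
  obtain ⟨hm, C, hC⟩ := hF
  choose s hs using fun n : ℕ => 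
    exists_simpleFunc_norm_sub_lt hm hC (Nat.one_div_pos_of_nat (n := n) (α := ℝ))
  refine ⟨s, Metric.tendstoUniformly_iff.2 fun ε hε => ?_⟩
  filter_upwards [tendsto_one_div_add_atTop_nhds_zero_nat.eventually_lt_const hε] with n hn z
  rw [dist_eq_norm']
  exact (hs n z).trans hn

namespace SpectralMeasure

variable (E : SpectralMeasure X) [CompleteSpace X]

/-- This justifies the `limUnder` in `boundedIntegral`: uniform density of simple functions makes
the filter nontrivial, and the norm bound makes its image Cauchy. -/
theorem tendsto_simpleIntegral {F : ℂ → ℂ} (hF : IsBoundedBorel F) :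
    Tendsto E.simpleIntegral (comap (fun s : SimpleFunc ℂ ℂ => UniformFun.ofFun (s : ℂ → ℂ))
      (𝓝 (UniformFun.ofFun F))) (𝓝 (E.boundedIntegral F)) := by
  obtain ⟨hm, C, hC⟩ := hF
  have hb := (UniformFun.hasBasis_nhds_of_basis ℂ ℂ (UniformFun.ofFun F)
    Metric.uniformity_basis_dist).comap (fun s : SimpleFunc ℂ ℂ => UniformFun.ofFun (s : ℂ → ℂ))
  have : (comap (fun s : SimpleFunc ℂ ℂ => UniformFun.ofFun (s : ℂ → ℂ))
      (𝓝 (UniformFun.ofFun F))).NeBot := by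
    refine hb.neBot_iff.2 fun {ε} hε => ?_
    obtain ⟨s, hs⟩ := exists_simpleFunc_norm_sub_lt hm hC hε
    exact ⟨s, fun z => by
      change dist (F z) (s z) < ε
      exact (dist_eq_norm' _ _).trans_lt (hs z)⟩
  refine tendsto_nhds_limUnder (cauchy_map_iff_exists_tendsto.1 ?_)
  refine (Metric.cauchy_iff.2 ⟨inferInstance, fun ε hε => ?_⟩)
  have hM := E.normBound_nonneg
  -- Simple functions within δ of `F` are within 2δ of each other; the `+ 1` covers a vanishing
  -- `normBound`.
  set δ := ε / (2 * (2 * E.normBound + 1)) with hδdef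
  have hδ : 0 < δ := by positivity
  refine ⟨_, image_mem_map (hb.mem_of_mem hδ), ?_⟩
  rintro _ ⟨s, hs, rfl⟩ _ ⟨t, ht, rfl⟩
  rw [dist_eq_norm]
  refine (E.norm_simpleIntegral_sub_le s t (C := 2 * δ) fun z => ?_).trans_lt ?_
  · have h1 : dist (F z) (s z) < δ := hs z
    have h2 : dist (F z) (t z) < δ := ht z
    rw [← dist_eq_norm]
    linarith [dist_triangle_left (s z) (t z) (F z)]
  · rw [hδdef, show E.normBound * (2 * (ε / (2 * (2 * E.normBound + 1)))) =
      ε * (E.normBound / (2 * E.normBound + 1)) by field_simp]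
    have : E.normBound / (2 * E.normBound + 1) < 1 := by rw [div_lt_one (by linarith)]; linarith
    nlinarith

theorem tendsto_simpleIntegral_of_tendstoUniformly {F : ℂ → ℂ} (hF : IsBoundedBorel F)
    {s : ℕ → SimpleFunc ℂ ℂ} (hs : TendstoUniformly (fun n => (s n : ℂ → ℂ)) F atTop) :
    Tendsto (fun n => E.simpleIntegral (s n)) atTop (𝓝 (E.boundedIntegral F)) :=
  (E.tendsto_simpleIntegral hF).comp
    (tendsto_comap_iff.2 (UniformFun.tendsto_iff_tendstoUniformly.2 hs))

end SpectralMeasure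

/-- Graph membership replaces the chosen limit and the domain proof by a single convergence
statement. -/
theorem mem_graph_strongLimit {ι : Type*} {l : Filter ι} [l.NeBot] {T : ι → X →L[ℂ] X} {x y : X} :
    (x, y) ∈ (strongLimit l T).graph ↔ Tendsto (fun i => T i x) l (𝓝 y) := by
  rw [LinearPMap.mem_graph_iff]
  constructor
  · rintro ⟨⟨x', hx'⟩, rfl, rfl⟩
    exact hx'.choose_spec
  · intro h
    have hx : ∃ y, Tendsto (fun i => T i x) l (𝓝 y) := ⟨y, h⟩
    exact ⟨⟨x, hx⟩, rfl, tendsto_nhds_unique hx.choose_spec h⟩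

theorem mem_graph_toPMap_top {T : X →ₗ[ℂ] X} {x y : X} :
    (x, y) ∈ (T.toPMap ⊤).graph ↔ T x = y := by
  simp [LinearPMap.mem_graph_iff]

theorem eq_of_mem_graph_iff {S T : X →ₗ.[ℂ] X}
    (h : ∀ x y, (x, y) ∈ S.graph ↔ (x, y) ∈ T.graph) : S = T :=
  LinearPMap.eq_of_eq_graph (Submodule.ext fun p => h p.1 p.2)

theorem tendstoUniformly_mul_of_bounded {s t : ℕ → ℂ → ℂ} {F G : ℂ → ℂ} {C D : ℝ}
    (hs : TendstoUniformly s F atTop) (ht : TendstoUniformly t G atTop)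
    (hF : ∀ z, ‖F z‖ ≤ C) (hG : ∀ z, ‖G z‖ ≤ D) :
    TendstoUniformly (fun n => s n * t n) (F * G) atTop := by
  have hC : 0 ≤ C := (norm_nonneg _).trans (hF 0)
  have hD : 0 ≤ D := (norm_nonneg _).trans (hG 0)
  rw [Metric.tendstoUniformly_iff] at hs ht ⊢
  intro ε hε
  -- With δ ≤ 1 the quadratic error is below δ, so the three errors total less than δ(1 + C + D).
  obtain ⟨δ, hδ0, hδ1, hδ⟩ : ∃ δ : ℝ, 0 < δ ∧ δ ≤ 1 ∧ δ * (1 + C + D) ≤ ε :=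
    ⟨min 1 (ε / (1 + C + D)), by positivity, min_le_left _ _,
      (le_div_iff₀ (by positivity)).1 (min_le_right _ _)⟩
  filter_upwards [hs δ hδ0, ht δ hδ0] with n h1 h2 z
  specialize h1 z
  specialize h2 z
  rw [dist_eq_norm'] at h1 h2 ⊢
  have key : (s n * t n) z - (F * G) z =
      (s n z - F z) * (t n z - G z) + F z * (t n z - G z) + (s n z - F z) * G z := by
    simp only [Pi.mul_apply]; ring
  rw [key]
  refine (norm_add₃_le).trans_lt ?_
  rw [norm_mul, norm_mul, norm_mul]
  have e1 := norm_nonneg (s n z - F z)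
  have e2 := norm_nonneg (t n z - G z)
  have h3 : ‖s n z - F z‖ * ‖t n z - G z‖ < δ * 1 := by
    calc _ ≤ ‖s n z - F z‖ * 1 := by gcongr; linarith
      _ < _ := by linarith
  have h4 : ‖F z‖ * ‖t n z - G z‖ ≤ C * δ := by gcongr; exact hF z
  have h5 : ‖s n z - F z‖ * ‖G z‖ ≤ δ * D := by gcongr; exact hG z
  nlinarith

namespace IsBoundedBorel

variable {F G : ℂ → ℂ}

theorem add (hF : IsBoundedBorel F) (hG : IsBoundedBorel G) : IsBoundedBorel (F + G) := by
  obtain ⟨hF, C, hC⟩ := hF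
  obtain ⟨hG, D, hD⟩ := hG
  exact ⟨hF.add hG, C + D, fun z => (norm_add_le _ _).trans (add_le_add (hC z) (hD z))⟩

theorem mul (hF : IsBoundedBorel F) (hG : IsBoundedBorel G) : IsBoundedBorel (F * G) := by
  obtain ⟨hF, C, hC⟩ := hF
  obtain ⟨hG, D, hD⟩ := hG
  exact ⟨hF.mul hG, C * D, fun z => (norm_mul_le _ _).trans
    (mul_le_mul (hC z) (hD z) (norm_nonneg _) ((norm_nonneg _).trans (hC z)))⟩

theorem const_smul (hF : IsBoundedBorel F) (c : ℂ) : IsBoundedBorel (c • F) := by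
  obtain ⟨hF, C, hC⟩ := hF
  refine ⟨hF.const_smul c, ‖c‖ * C, fun z => ?_⟩
  rw [Pi.smul_apply, norm_smul]
  exact mul_le_mul_of_nonneg_left (hC z) (norm_nonneg _)

theorem sub (hF : IsBoundedBorel F) (hG : IsBoundedBorel G) : IsBoundedBorel (F - G) := by
  have := hF.add (hG.const_smul (-1))
  rwa [neg_one_smul, ← sub_eq_add_neg] at this

theorem indicator_one {s : Set ℂ} (hs : MeasurableSet s) : IsBoundedBorel (s.indicator 1) :=
  ⟨measurable_one.indicator hs, 1, fun z => (norm_indicator_le_norm_self _ _).trans (by simp)⟩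

theorem indicator (hF : Measurable F) {s : Set ℂ} (hs : MeasurableSet s) {C : ℝ}
    (hC : ∀ z ∈ s, ‖F z‖ ≤ C) : IsBoundedBorel (s.indicator F) := by
  refine ⟨hF.indicator hs, max C 0, fun z => ?_⟩
  by_cases hz : z ∈ s
  · rw [Set.indicator_of_mem hz]; exact (hC z hz).trans (le_max_left _ _)
  · simp [Set.indicator_of_notMem hz]

theorem truncation (hF : Measurable F) (r : ℝ) :
    IsBoundedBorel ({z | ‖F z‖ ≤ r}.indicator F) :=
  indicator hF (measurableSet_le hF.norm measurable_const) fun _ hz => hz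

theorem simpleFunc (s : SimpleFunc ℂ ℂ) : IsBoundedBorel s :=
  ⟨s.measurable, s.exists_forall_norm_le⟩

end IsBoundedBorel

/-! ### The operational calculus -/

namespace SpectralMeasure

variable (E : SpectralMeasure X) {F G : ℂ → ℂ}

theorem tendsto_proj_norm_le (hF : Measurable F) (x : X) :
    Tendsto (fun n : ℕ => E.proj {z | ‖F z‖ ≤ n} x) atTop (𝓝 x) := by
  have h := E.tendsto_proj_iUnion (s := fun n : ℕ => {z | ‖F z‖ ≤ n})
    (fun m n hmn z hz => le_trans (Set.mem_ofPred.1 hz) (Nat.cast_le.2 hmn))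
    (fun n => measurableSet_le hF.norm measurable_const) x
  have hU : ⋃ n : ℕ, {z | ‖F z‖ ≤ n} = Set.univ :=
    Set.iUnion_eq_univ_iff.2 fun z => exists_nat_ge ‖F z‖
  rwa [hU, E.map_univ] at h

variable {E} in
theorem mem_graph_integral {x y : X} : (x, y) ∈ (E.integral F).graph ↔
    Tendsto (fun n : ℕ => E.boundedIntegral ({z | ‖F z‖ ≤ n}.indicator F) x) atTop (𝓝 y) :=
  mem_graph_strongLimit

theorem mem_graph_integral_of_bounded (hF : IsBoundedBorel F) {x y : X} :
    (x, y) ∈ (E.integral F).graph ↔ E.boundedIntegral F x = y := by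
  rw [mem_graph_integral]
  obtain ⟨C, hC⟩ := hF.2
  obtain ⟨N, hN⟩ := exists_nat_ge C
  have h : Tendsto (fun n : ℕ => E.boundedIntegral ({z | ‖F z‖ ≤ n}.indicator F) x) atTop
      (𝓝 (E.boundedIntegral F x)) := by
    refine tendsto_const_nhds.congr' ((eventually_ge_atTop N).mono fun n hn => ?_)
    have hS : {z | ‖F z‖ ≤ n}.indicator F = F :=
      Set.indicator_eq_self.2 fun z _ => (hC z).trans (hN.trans (Nat.cast_le.2 hn))
    simp only [hS]
  exact ⟨fun h' => tendsto_nhds_unique h h', fun h' => h' ▸ h⟩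

/-- The projections of `y` tend to `y`, so it suffices to check the truncated identities. -/
theorem mem_graph_of_forall_proj (hF : Measurable F) {x y : X}
    (h : ∀ n : ℕ, E.proj {z | ‖F z‖ ≤ n} y =
      E.boundedIntegral ({z | ‖F z‖ ≤ n}.indicator F) x) : (x, y) ∈ (E.integral F).graph :=
  mem_graph_integral.2 ((E.tendsto_proj_norm_le hF y).congr h)

variable [CompleteSpace X]

theorem boundedIntegral_simpleFunc (s : SimpleFunc ℂ ℂ) :
    E.boundedIntegral s = E.simpleIntegral s := by
  refine tendsto_nhds_unique (E.tendsto_simpleIntegral_of_tendstoUniformly (s := fun _ => s)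
    (.simpleFunc s) ?_) tendsto_const_nhds
  exact Metric.tendstoUniformly_iff.2 fun ε hε => .of_forall fun _ _ => by simpa using hε

theorem boundedIntegral_add (hF : IsBoundedBorel F) (hG : IsBoundedBorel G) :
    E.boundedIntegral (F + G) = E.boundedIntegral F + E.boundedIntegral G := by
  obtain ⟨s, hs⟩ := hF.exists_seq_tendstoUniformly
  obtain ⟨t, ht⟩ := hG.exists_seq_tendstoUniformly
  refine tendsto_nhds_unique (E.tendsto_simpleIntegral_of_tendstoUniformly
    (s := fun n => s n + t n) (hF.add hG) (hs.add ht)) ?_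
  simp only [simpleIntegral_add]
  exact (E.tendsto_simpleIntegral_of_tendstoUniformly hF hs).add
    (E.tendsto_simpleIntegral_of_tendstoUniformly hG ht)

theorem boundedIntegral_mul (hF : IsBoundedBorel F) (hG : IsBoundedBorel G) :
    E.boundedIntegral (F * G) = E.boundedIntegral F * E.boundedIntegral G := by
  obtain ⟨s, hs⟩ := hF.exists_seq_tendstoUniformly
  obtain ⟨t, ht⟩ := hG.exists_seq_tendstoUniformly
  obtain ⟨C, hC⟩ := hF.2
  obtain ⟨D, hD⟩ := hG.2
  refine tendsto_nhds_unique (E.tendsto_simpleIntegral_of_tendstoUniformly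
    (s := fun n => s n * t n) (hF.mul hG) (tendstoUniformly_mul_of_bounded hs ht hC hD)) ?_
  simp only [simpleIntegral_mul]
  exact (E.tendsto_simpleIntegral_of_tendstoUniformly hF hs).mul
    (E.tendsto_simpleIntegral_of_tendstoUniformly hG ht)

theorem boundedIntegral_mul_apply (hF : IsBoundedBorel F) (hG : IsBoundedBorel G) (x : X) :
    E.boundedIntegral (F * G) x = E.boundedIntegral F (E.boundedIntegral G x) := by
  rw [E.boundedIntegral_mul hF hG]; rfl

theorem boundedIntegral_indicator_one {s : Set ℂ} (hs : MeasurableSet s) :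
    E.boundedIntegral (s.indicator 1) = E.proj s := by
  classical
  let f : SimpleFunc ℂ Bool := .piecewise s hs (.const ℂ true) (.const ℂ false)
  have h := E.simpleIntegral_map f fun b => cond b 1 0
  rw [Finset.sum_subset (Finset.subset_univ _) (fun b _ hb => by
    rw [SimpleFunc.preimage_eq_empty_iff f b |>.2 (by simpa using hb), E.map_empty, smul_zero]),
    Fintype.sum_bool] at h
  have hf : f ⁻¹' {true} = s := by
    ext z
    by_cases hz : z ∈ s <;> simp [f, hz]
  have hfs : ⇑(f.map fun b => cond b (1 : ℂ) 0) = s.indicator 1 := by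
    ext z
    by_cases hz : z ∈ s <;> simp [f, hz]
  rw [← hfs, boundedIntegral_simpleFunc, h, hf]
  simp

theorem norm_boundedIntegral_le (hF : Measurable F) {C : ℝ} (hC : ∀ z, ‖F z‖ ≤ C) :
    ‖E.boundedIntegral F‖ ≤ E.normBound * C := by
  have hB : IsBoundedBorel F := ⟨hF, C, hC⟩
  obtain ⟨s, hs⟩ := hB.exists_seq_tendstoUniformly
  -- The approximants are bounded only by `C + ε`; the excess is removed by letting ε tend to 0.
  have hlim : Tendsto (fun ε : ℝ => E.normBound * (C + ε)) (𝓝[>] 0) (𝓝 (E.normBound * C)) := by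
    have : Continuous fun ε : ℝ => E.normBound * (C + ε) := by fun_prop
    simpa using (this.tendsto 0).mono_left nhdsWithin_le_nhds
  refine ge_of_tendsto hlim (eventually_mem_nhdsWithin.mono fun ε hε => ?_)
  refine le_of_tendsto (E.tendsto_simpleIntegral_of_tendstoUniformly hB hs).norm
    ((Metric.tendstoUniformly_iff.1 hs ε hε).mono fun n hn => ?_)
  refine E.norm_simpleIntegral_le _ fun z => ?_
  have := hn z
  rw [dist_eq_norm'] at this
  linarith [norm_le_norm_add_norm_sub' (s n z) (F z), hC z]

theorem boundedIntegral_smul (c : ℂ) (hF : IsBoundedBorel F) :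
    E.boundedIntegral (c • F) = c • E.boundedIntegral F := by
  obtain ⟨s, hs⟩ := hF.exists_seq_tendstoUniformly
  refine tendsto_nhds_unique (E.tendsto_simpleIntegral_of_tendstoUniformly
    (s := fun n => c • s n) (hF.const_smul c)
      ((uniformContinuous_const_smul c).comp_tendstoUniformly hs)) ?_
  simp only [simpleIntegral_smul]
  exact (E.tendsto_simpleIntegral_of_tendstoUniformly hF hs).const_smul c

theorem boundedIntegral_sub (hF : IsBoundedBorel F) (hG : IsBoundedBorel G) :
    E.boundedIntegral (F - G) = E.boundedIntegral F - E.boundedIntegral G := by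
  rw [sub_eq_add_neg, ← neg_one_smul ℂ G, E.boundedIntegral_add hF (hG.const_smul _),
    E.boundedIntegral_smul _ hG, neg_one_smul, sub_eq_add_neg]

theorem boundedIntegral_comm (hF : IsBoundedBorel F) (hG : IsBoundedBorel G) (x : X) :
    E.boundedIntegral F (E.boundedIntegral G x) = E.boundedIntegral G (E.boundedIntegral F x) := by
  rw [← E.boundedIntegral_mul_apply hF hG, ← E.boundedIntegral_mul_apply hG hF, mul_comm]

/-- The integral of a bounded function which vanishes off `s` only depends on `E s x`. -/
theorem boundedIntegral_indicator {s : Set ℂ} (hs : MeasurableSet s) (hF : IsBoundedBorel F)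
    (x : X) : E.boundedIntegral (s.indicator F) x = E.boundedIntegral F (E.proj s x) := by
  rw [← E.boundedIntegral_indicator_one hs, ← E.boundedIntegral_mul_apply hF (.indicator_one hs)]
  congr 2
  ext z
  by_cases hz : z ∈ s <;> simp [hz]

/-- Bounded convergence: `x` is split by a large disc. The outer part of `x` is small and the
integrands are bounded by `C`; on the disc the integrands converge uniformly. -/
theorem tendsto_boundedIntegral_apply {ι : Type*} {l : Filter ι} {G : ι → ℂ → ℂ} {C : ℝ}
    (hG : ∀ i, Measurable (G i)) (hF : Measurable F) (hGC : ∀ᶠ i in l, ∀ z, ‖G i z‖ ≤ C)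
    (hFC : ∀ z, ‖F z‖ ≤ C)
    (hu : ∀ N : ℕ, TendstoUniformlyOn G F l {z | ‖z‖ ≤ N}) (x : X) :
    Tendsto (fun i => E.boundedIntegral (G i) x) l (𝓝 (E.boundedIntegral F x)) := by
  have hM := E.normBound_nonneg
  have hC : 0 ≤ C := (norm_nonneg _).trans (hFC 0)
  have hFB : IsBoundedBorel F := ⟨hF, C, hFC⟩
  refine Metric.tendsto_nhds.2 fun ε hε => ?_
  have hN : ∃ N : ℕ, E.normBound * (2 * C) * ‖x - E.proj {z | ‖z‖ ≤ N} x‖ < ε / 2 := by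
    have h1 := ((tendsto_const_nhds (x := x)).sub
      (E.tendsto_proj_norm_le measurable_id x)).norm.const_mul (E.normBound * (2 * C))
    rw [sub_self, norm_zero, mul_zero] at h1
    exact (h1.eventually_lt_const (half_pos hε)).exists
  obtain ⟨N, hN⟩ := hN
  have hS : MeasurableSet {z : ℂ | ‖z‖ ≤ N} := measurableSet_le measurable_norm measurable_const
  set δ := ε / (2 * (E.normBound * ‖x‖ + 1)) with hδdef
  have hδ : 0 < δ := by positivity
  filter_upwards [hGC, Metric.tendstoUniformlyOn_iff.1 (hu N) δ hδ] with i hi hiN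
  have hGB : IsBoundedBorel (G i) := ⟨hG i, C, hi⟩
  have hD := hGB.sub hFB
  rw [dist_eq_norm, ← sub_apply, ← E.boundedIntegral_sub hGB hFB]
  have hx : x = (x - E.proj {z | ‖z‖ ≤ N} x) + E.proj {z | ‖z‖ ≤ N} x := by abel
  rw [congrArg (E.boundedIntegral (G i - F)) hx, map_add, ← E.boundedIntegral_indicator hS hD]
  have b1 : ‖E.boundedIntegral (G i - F)‖ ≤ E.normBound * (2 * C) :=
    E.norm_boundedIntegral_le hD.1 fun z => by
      refine (norm_sub_le _ _).trans ?_
      linarith [hi z, hFC z]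
  have b2 : ‖E.boundedIntegral ({z : ℂ | ‖z‖ ≤ N}.indicator (G i - F))‖ ≤ E.normBound * δ :=
    E.norm_boundedIntegral_le (hD.1.indicator hS) fun z => by
      by_cases hz : z ∈ {z : ℂ | ‖z‖ ≤ N}
      · rw [Set.indicator_of_mem hz, Pi.sub_apply, ← dist_eq_norm']
        exact (hiN z hz).le
      · rw [Set.indicator_of_notMem hz, norm_zero]; exact hδ.le
  have b3 : E.normBound * δ * ‖x‖ ≤ ε / 2 := by
    rw [hδdef, mul_right_comm, ← mul_div_assoc, div_le_iff₀ (by positivity)]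
    nlinarith
  calc _ ≤ _ := norm_add_le _ _
    _ ≤ E.normBound * (2 * C) * ‖x - E.proj {z | ‖z‖ ≤ N} x‖ + E.normBound * δ * ‖x‖ :=
      add_le_add (ContinuousLinearMap.le_of_opNorm_le _ b1 _)
        (ContinuousLinearMap.le_of_opNorm_le _ b2 _)
    _ < ε := by linarith

/-- Truncating `F` at level n turns the left side into the projection to {|F| ≤ n} of the right
side, and these projections tend strongly to the identity. -/
theorem boundedIntegral_apply_of_mem_graph (hF : Measurable F) (hG : IsBoundedBorel G)
    (hGF : IsBoundedBorel (G * F)) {x y : X} (h : (x, y) ∈ (E.integral F).graph) :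
    E.boundedIntegral G y = E.boundedIntegral (G * F) x := by
  rw [mem_graph_integral] at h
  refine tendsto_nhds_unique (((E.boundedIntegral G).continuous.tendsto y).comp h) ?_
  refine (E.tendsto_proj_norm_le hF (E.boundedIntegral (G * F) x)).congr fun n => ?_
  have hS : MeasurableSet {z : ℂ | ‖F z‖ ≤ n} := measurableSet_le hF.norm measurable_const
  rw [Function.comp_apply, ← E.boundedIntegral_mul_apply hG (.truncation hF n),
    ← E.boundedIntegral_indicator_one hS, ← E.boundedIntegral_mul_apply (.indicator_one hS) hGF]
  congr 2
  ext z
  by_cases hz : ‖F z‖ ≤ n <;> simp [hz]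

end SpectralMeasure

/-! ### Orbits bounded or bounded away from zero -/

theorem not_isHypercyclicFamily {J : Type*} (T : J → X →ₗ.[ℂ] X)
    (h : ∀ (f : X) (hf : ∀ j, f ∈ (T j).domain), f ≠ 0 →
      (∃ c : ℝ, 0 < c ∧ ∀ j, c ≤ ‖T j ⟨f, hf j⟩‖) ∨ (∃ C : ℝ, ∀ j, ‖T j ⟨f, hf j⟩‖ ≤ C)) :
    ¬ IsHypercyclicFamily T := by
  rintro ⟨f, hf0, hf, hd⟩
  rcases h f hf hf0 with ⟨c, hc, hle⟩ | ⟨C, hC⟩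
  · obtain ⟨_, ⟨j, rfl⟩, hj⟩ := hd.exists_dist_lt 0 hc
    rw [dist_zero_left] at hj
    exact (hle j).not_gt hj
  · obtain ⟨g, hg⟩ : ∃ g : X, C + 1 ≤ ‖g‖ := by
      have : Nontrivial X := ⟨f, 0, hf0⟩
      exact NormedSpace.exists_lt_norm ℂ X (C + 1) |>.imp fun _ => le_of_lt
    obtain ⟨_, ⟨j, rfl⟩, hj⟩ := hd.exists_dist_lt g one_pos
    rw [dist_eq_norm] at hj
    linarith [hC j, norm_le_norm_add_norm_sub' g (T j ⟨f, hf j⟩)]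

namespace SpectralMeasure

variable (E : SpectralMeasure X)

theorem proj_add_proj_compl {s : Set ℂ} (hs : MeasurableSet s) : E.proj s + E.proj sᶜ = 1 := by
  rw [← E.proj_union hs hs.compl disjoint_compl_right, Set.union_compl_self, E.map_univ]

variable [CompleteSpace X] {F : ℂ → ℂ}

/-- If each `F j` has modulus at least one on `s` and at most one off `s`, then the vectors
`∫ F j dE f` are bounded away from zero or bounded. -/
theorem norm_integral_dichotomy {J : Type*} {F : J → ℂ → ℂ} (hF : ∀ j, Measurable (F j))
    {s : Set ℂ} (hs : MeasurableSet s) (h1 : ∀ j, ∀ z ∈ s, 1 ≤ ‖F j z‖)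
    (h2 : ∀ j, ∀ z ∉ s, ‖F j z‖ ≤ 1) {f : X} {y : J → X}
    (hy : ∀ j, (f, y j) ∈ (E.integral (F j)).graph) :
    (∃ c : ℝ, 0 < c ∧ ∀ j, c ≤ ‖y j‖) ∨ ∃ C : ℝ, ∀ j, ‖y j‖ ≤ C := by
  have hM := E.normBound_nonneg
  by_cases hf : E.proj s f = 0
  · have hf' : E.proj sᶜ f = f := by
      have := congrArg (fun T : X →L[ℂ] X => T f) (E.proj_add_proj_compl hs)
      simpa [hf] using this
    refine .inr ⟨E.normBound * 1 * ‖f‖, fun j => ?_⟩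
    refine le_of_tendsto (mem_graph_integral.1 (hy j)).norm (.of_forall fun n => ?_)
    have hB := IsBoundedBorel.truncation (hF j) n
    conv_lhs => rw [← hf', ← E.boundedIntegral_indicator hs.compl hB]
    refine ContinuousLinearMap.le_of_opNorm_le _
      (E.norm_boundedIntegral_le (hB.1.indicator hs.compl) fun z => ?_) _
    by_cases hz : z ∈ s
    · simp [hz]
    · rw [Set.indicator_of_mem (s := sᶜ) hz]
      exact (norm_indicator_le_norm_self _ _).trans (h2 j z hz)
  -- The function 1/F_j on `s`, extended by zero, maps `y j` to `E.proj s f` with norm at most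
  -- `normBound`; the `+ 1` keeps the denominator positive.
  · refine .inl ⟨‖E.proj s f‖ / (E.normBound + 1), by positivity, fun j => ?_⟩
    have hGb : ∀ z, ‖s.indicator (fun z => (F j z)⁻¹) z‖ ≤ 1 := fun z => by
      by_cases hz : z ∈ s
      · rw [Set.indicator_of_mem hz, norm_inv]
        exact inv_le_one_of_one_le₀ (h1 j z hz)
      · simp [hz]
    have hG : IsBoundedBorel (s.indicator fun z => (F j z)⁻¹) :=
      ⟨(hF j).inv.indicator hs, 1, hGb⟩
    have hGF : (s.indicator fun z => (F j z)⁻¹) * F j = s.indicator 1 := by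
      ext z
      by_cases hz : z ∈ s
      · have : F j z ≠ 0 := norm_pos_iff.1 (one_pos.trans_le (h1 j z hz))
        simp [hz, this]
      · simp [hz]
    have h := E.boundedIntegral_apply_of_mem_graph (hF j) hG
      (hGF ▸ IsBoundedBorel.indicator_one hs) (hy j)
    rw [hGF, E.boundedIntegral_indicator_one hs] at h
    rw [← h, div_le_iff₀ (by linarith)]
    have := ContinuousLinearMap.le_of_opNorm_le _ (E.norm_boundedIntegral_le hG.1 hGb) (y j)
    linarith [norm_nonneg (y j)]

/-- Supplies domain vectors: projecting to a set where `F` is bounded lands in the domain of its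
integral. -/
theorem mem_graph_proj (hF : Measurable F) {s : Set ℂ} (hs : MeasurableSet s)
    (hB : IsBoundedBorel (s.indicator F)) (x : X) :
    (E.proj s x, E.boundedIntegral (s.indicator F) x) ∈ (E.integral F).graph := by
  refine E.mem_graph_of_forall_proj hF fun n => ?_
  have hS : MeasurableSet {z : ℂ | ‖F z‖ ≤ n} := measurableSet_le hF.norm measurable_const
  rw [← E.boundedIntegral_indicator_one hS, ← E.boundedIntegral_indicator_one hs,
    ← E.boundedIntegral_mul_apply (.indicator_one hS) hB,
    ← E.boundedIntegral_mul_apply (.truncation hF n) (.indicator_one hs)]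
  congr 2
  ext z
  by_cases hz : z ∈ s <;> by_cases hz' : ‖F z‖ ≤ n <;> simp [hz, hz']

end SpectralMeasure

/-! ### Powers, spectrum and exponentials of the operator -/

section Operator

variable [CompleteSpace X] {A : X →ₗ.[ℂ] X} {E : SpectralMeasure X}

theorem IsScalarTypeSpectral.boundedIntegral_opPow (hA : IsScalarTypeSpectral A E) (n : ℕ) (f : X)
    (hf : f ∈ (opPow A n).domain) {G : ℂ → ℂ} (hG : IsBoundedBorel G)
    (hGn : IsBoundedBorel (G * fun z => z ^ n)) :
    E.boundedIntegral G (opPow A n ⟨f, hf⟩) = E.boundedIntegral (G * fun z => z ^ n) f := by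
  induction n generalizing G with
  | zero =>
    have : (G * fun z => z ^ 0) = G := by ext z; simp
    rw [this]; rfl
  | succ n ih =>
    obtain ⟨h, h'⟩ := hf
    -- Where |z| ≤ 1, |Gz| ≤ |G|; elsewhere |Gz| ≤ |Gz^(n+1)|. Hence the bound `C + D`.
    have hG1 : IsBoundedBorel (G * fun z => z) := by
      obtain ⟨C, hC⟩ := hG.2
      obtain ⟨D, hD⟩ := hGn.2
      refine ⟨hG.1.mul measurable_id, C + D, fun z => ?_⟩
      have hC' := hC z
      have hD' := hD z
      simp only [Pi.mul_apply, norm_mul, norm_pow] at hD' ⊢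
      have hGz := norm_nonneg (G z)
      rcases le_total ‖z‖ 1 with hz | hz
      · have : 0 ≤ ‖G z‖ * ‖z‖ ^ (n + 1) := by positivity
        nlinarith
      · have : ‖z‖ ≤ ‖z‖ ^ (n + 1) := le_self_pow₀ hz n.succ_ne_zero
        nlinarith
    have e : (G * fun z => z ^ (n + 1)) = (G * fun z => z) * fun z => z ^ n := by
      ext z; simp only [Pi.mul_apply]; ring
    have hgr : (opPow A n ⟨f, h⟩, A ⟨opPow A n ⟨f, h⟩, h'⟩) ∈ (E.integral fun z => z).graph := by
      rw [← show A = E.integral fun z => z from hA]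
      exact A.mem_graph ⟨opPow A n ⟨f, h⟩, h'⟩
    have key := E.boundedIntegral_apply_of_mem_graph measurable_id hG hG1 hgr
    rw [e] at hGn ⊢
    rw [← ih h hG1 hGn]
    exact key

/-- Only this inclusion of graphs is needed. It follows by taking indicators of {|z^n| ≤ m} for `G`
above. -/
theorem IsScalarTypeSpectral.mem_graph_opPow (hA : IsScalarTypeSpectral A E) (n : ℕ) (f : X)
    (hf : f ∈ (opPow A n).domain) :
    (f, opPow A n ⟨f, hf⟩) ∈ (E.integral fun z => z ^ n).graph := by
  have hm : Measurable fun z : ℂ => z ^ n := measurable_id.pow_const n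
  refine E.mem_graph_of_forall_proj hm fun m => ?_
  have hS : MeasurableSet {z : ℂ | ‖z ^ n‖ ≤ m} := measurableSet_le hm.norm measurable_const
  have e : ({z : ℂ | ‖z ^ n‖ ≤ m}.indicator 1 * fun z => z ^ n) =
      {z : ℂ | ‖z ^ n‖ ≤ m}.indicator fun z => z ^ n := by
    ext z
    by_cases hz : ‖z ^ n‖ ≤ m <;> simp [hz, -norm_pow]
  rw [← E.boundedIntegral_indicator_one hS, ← e]
  exact hA.boundedIntegral_opPow n f hf (.indicator_one hS) (e ▸ .truncation hm m)

theorem IsScalarTypeSpectral.opPow_dichotomy (hA : IsScalarTypeSpectral A E) (f : X)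
    (hf : ∀ n, f ∈ (opPow A n).domain) :
    (∃ c : ℝ, 0 < c ∧ ∀ n, c ≤ ‖opPow A n ⟨f, hf n⟩‖) ∨
      (∃ C : ℝ, ∀ n, ‖opPow A n ⟨f, hf n⟩‖ ≤ C) := by
  refine E.norm_integral_dichotomy (fun n => measurable_id.pow_const n)
    (s := {z | 1 < ‖z‖}) (measurableSet_lt measurable_const measurable_norm) (fun n z hz => ?_)
    (fun n z hz => ?_) fun n => hA.mem_graph_opPow n f (hf n)
  · simpa using one_le_pow₀ (n := n) (le_of_lt hz)
  · simpa using pow_le_one₀ (n := n) (norm_nonneg z) (not_lt.1 hz)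


/-- Neumann series: with S = 1 - (z - z₀)R invertible, (A - z)R = S, and R S⁻¹ is the resolvent at
z. Closedness makes the spectrum Borel. -/
theorem isClosed_opSpectrum (A : X →ₗ.[ℂ] X) : IsClosed (opSpectrum A) := by
  refine isClosed_compl_iff.2 (Metric.isOpen_iff.2 ?_)
  rintro z₀ ⟨R, hR1, hR2⟩
  refine ⟨1 / (‖R‖ + 1), by positivity, fun z hz => ?_⟩
  have hlt : ‖(z - z₀) • R‖ < 1 := by
    rw [Metric.mem_ball, dist_eq_norm, lt_div_iff₀ (by positivity)] at hz
    rw [norm_smul]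
    nlinarith [norm_nonneg (z - z₀), norm_nonneg R]
  set S := Units.oneSub ((z - z₀) • R) hlt with hS
  have hSapply (x : X) : (S : X →L[ℂ] X) x = x - (z - z₀) • R x := by
    rw [hS, Units.val_oneSub]; rfl
  have hcomm : Commute R (S : X →L[ℂ] X) := by
    rw [hS, Units.val_oneSub]
    exact (Commute.one_right R).sub_right ((Commute.refl R).smul_right _)
  refine ⟨R * (↑S⁻¹ : X →L[ℂ] X), fun y => ?_, fun x => ?_⟩
  · obtain ⟨w, hw⟩ : ∃ w, w = (↑S⁻¹ : X →L[ℂ] X) y := ⟨_, rfl⟩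
    have h1 : (S : X →L[ℂ] X) w = y := by
      rw [hw, ← mul_apply_eq_comp, S.mul_inv]; rfl
    simp only [mul_apply_eq_comp, ← hw]
    obtain ⟨h, hy⟩ := hR1 w
    have hgoal : A ⟨R w, h⟩ - z • R w = y := by
      rw [hSapply, sub_smul] at h1
      rw [← h1, ← sub_eq_zero, ← sub_eq_zero.2 hy]
      abel
    exact ⟨h, hgoal⟩
  · rw [hcomm.units_inv_right.eq, mul_apply_eq_comp]
    have h1 : R (A x - z • (x : X)) = (S : X →L[ℂ] X) x := by
      have h2 := hR2 x
      rw [hSapply, sub_smul, ← sub_eq_zero, ← sub_eq_zero.2 h2]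
      simp only [map_sub, map_smul]
      abel
    rw [h1, ← mul_apply_eq_comp, S.inv_mul]; rfl

/-- On the range of the projection of a ball of radius r, A - z₀ has norm at most `normBound * r`,
yet R inverts it. For small r this forces the range to be zero. -/
theorem IsScalarTypeSpectral.exists_proj_ball_eq_zero (hA : IsScalarTypeSpectral A E) {z₀ : ℂ}
    (hz : z₀ ∉ opSpectrum A) : ∃ r > 0, E.proj (Metric.ball z₀ r) = 0 := by
  obtain ⟨R, -, hR⟩ := not_not.1 hz
  have hM := E.normBound_nonneg
  refine ⟨1 / (‖R‖ * E.normBound + 1), by positivity, ?_⟩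
  set r := 1 / (‖R‖ * E.normBound + 1) with hr
  have hr0 : 0 < r := by positivity
  have hB : MeasurableSet (Metric.ball z₀ r) := measurableSet_ball
  have hid : IsBoundedBorel ((Metric.ball z₀ r).indicator fun z => z) :=
    .indicator measurable_id' hB (C := ‖z₀‖ + r) fun z hz => by
      rw [Metric.mem_ball, dist_eq_norm] at hz
      linarith [norm_le_norm_add_norm_sub' z z₀]
  ext x
  have hgr := E.mem_graph_proj measurable_id' hB hid x
  rw [← show A = E.integral fun z => z from hA, LinearPMap.mem_graph_iff] at hgr
  obtain ⟨u, hu, hAu⟩ := hgr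
  simp only at hu hAu
  have hRu := hR u
  have hone : IsBoundedBorel ((Metric.ball z₀ r).indicator 1) := .indicator_one hB
  have hd : ∀ z, ‖((Metric.ball z₀ r).indicator (fun z => z) -
      z₀ • (Metric.ball z₀ r).indicator (1 : ℂ → ℂ)) z‖ ≤ r := fun z => by
    by_cases hz : z ∈ Metric.ball z₀ r
    · simpa [hz, dist_eq_norm] using (Metric.mem_ball.1 hz).le
    · simp [hz, hr0.le]
  have hnorm : ‖A u - z₀ • (u : X)‖ ≤ E.normBound * r * ‖(u : X)‖ := by
    have hx : (E.boundedIntegral ((Metric.ball z₀ r).indicator (fun z => z) -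
        z₀ • (Metric.ball z₀ r).indicator 1)) (u : X) = A u - z₀ • (u : X) := by
      rw [E.boundedIntegral_sub hid (hone.const_smul _), E.boundedIntegral_smul _ hone,
        E.boundedIntegral_indicator_one hB, hAu, hu, sub_apply, smul_apply,
        ← E.boundedIntegral_indicator_one hB, ← E.boundedIntegral_mul_apply hid hone,
        ← E.boundedIntegral_mul_apply hone hone]
      congr 3
      · ext z; by_cases hz : z ∈ Metric.ball z₀ r <;> simp [hz]
      · congr 1
        ext z; by_cases hz : z ∈ Metric.ball z₀ r <;> simp [hz]
    rw [← hx]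
    exact ContinuousLinearMap.le_of_opNorm_le _
      (E.norm_boundedIntegral_le (hid.sub (hone.const_smul z₀)).1 hd) _
  have hle : ‖(u : X)‖ ≤ ‖R‖ * E.normBound * r * ‖(u : X)‖ := by
    calc ‖(u : X)‖ = ‖R (A u - z₀ • (u : X))‖ := by rw [hRu]
      _ ≤ ‖R‖ * (E.normBound * r * ‖(u : X)‖) := R.le_opNorm_of_le hnorm
      _ = _ := by ring
  have hlt : ‖R‖ * E.normBound * r < 1 := by
    rw [hr, mul_one_div, div_lt_one (by positivity)]; linarith
  have : ‖(u : X)‖ = 0 := by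
    by_contra h
    have := (norm_nonneg (u : X)).lt_of_ne' h
    nlinarith
  rw [← hu, norm_eq_zero.1 this]; rfl

/-- By the Lindelöf property, countably many balls of zero projection cover the resolvent set. -/
theorem IsScalarTypeSpectral.proj_opSpectrum (hA : IsScalarTypeSpectral A E) :
    E.proj (opSpectrum A) = 1 := by
  have hm : MeasurableSet (opSpectrum A) := (isClosed_opSpectrum A).measurableSet
  rw [← E.proj_add_proj_compl hm, left_eq_add]
  have hr : ∀ z : ℂ, ∃ r, z ∈ (opSpectrum A)ᶜ → 0 < r ∧ E.proj (Metric.ball z r) = 0 := fun z => by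
    by_cases hz : z ∈ opSpectrum A
    · exact ⟨0, fun h => absurd hz h⟩
    · obtain ⟨r, h⟩ := hA.exists_proj_ball_eq_zero hz
      exact ⟨r, fun _ => h⟩
  choose r hr using hr
  obtain ⟨t, hts, htc, hcov⟩ := TopologicalSpace.countable_cover_nhdsWithin
    (s := (opSpectrum A)ᶜ) (f := fun z => Metric.ball z (r z))
    fun z hz => mem_nhdsWithin_of_mem_nhds (Metric.ball_mem_nhds z (hr z hz).1)
  rcases t.eq_empty_or_nonempty with rfl | hne
  · rw [Set.subset_eq_empty hcov (by simp), E.map_empty]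
  · obtain ⟨u, rfl⟩ := htc.exists_eq_range hne
    have h0 := E.proj_iUnion_eq_zero (s := fun n => Metric.ball (u n) (r (u n)))
      (fun n => measurableSet_ball) fun n => (hr _ (hts ⟨n, rfl⟩)).2
    rw [Set.biUnion_range] at hcov
    rw [← Set.inter_eq_left.2 hcov, E.map_inter _ _ hm.compl
      (.iUnion fun n => measurableSet_ball), h0, mul_zero]

/-- Off the spectrum the integrand is zero, so those points join the part where the modulus is at
most one. -/
theorem opExp_dichotomy (A : X →ₗ.[ℂ] X) (E : SpectralMeasure X) (f : X)
    (hf : ∀ t : ℝ≥0, f ∈ (opExp A E t).domain) :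
    (∃ c : ℝ, 0 < c ∧ ∀ t : ℝ≥0, c ≤ ‖opExp A E t ⟨f, hf t⟩‖) ∨
      (∃ C : ℝ, ∀ t : ℝ≥0, ‖opExp A E t ⟨f, hf t⟩‖ ≤ C) := by
  have hm : MeasurableSet (opSpectrum A) := (isClosed_opSpectrum A).measurableSet
  refine E.norm_integral_dichotomy
    (F := fun (t : ℝ≥0) => (opSpectrum A).indicator fun z => Complex.exp ((t : ℝ) * z))
    (fun t => Measurable.indicator (by fun_prop) hm) (s := opSpectrum A ∩ {z | 0 < z.re})
    (hm.inter (measurableSet_lt measurable_const Complex.measurable_re)) (fun t z hz => ?_)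
    (fun t z hz => ?_) fun t => (opExp A E t).mem_graph ⟨f, hf t⟩
  · rw [Set.indicator_of_mem hz.1, Complex.norm_exp, Complex.re_ofReal_mul]
    exact Real.one_le_exp (mul_nonneg t.2 (le_of_lt hz.2))
  · by_cases hzA : z ∈ opSpectrum A
    · rw [Set.indicator_of_mem hzA, Complex.norm_exp, Complex.re_ofReal_mul]
      exact Real.exp_le_one_iff.2
        (mul_nonpos_of_nonneg_of_nonpos t.2 (not_lt.1 fun h => hz ⟨hzA, h⟩))
    · simp [hzA]

end Operator

/-! ### The semigroup and its generator -/

theorem norm_dslope_exp_le (z : ℂ) : ‖dslope Complex.exp 0 z‖ ≤ Real.exp (max z.re 0) := by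
  rcases eq_or_ne z 0 with rfl | hz
  · simp [dslope_same]
  -- Mean value inequality on a half-plane containing both 0 and z.
  · have h := (convex_halfSpace_re_le (max z.re 0)).norm_image_sub_le_of_norm_deriv_le
      (f := Complex.exp) (C := Real.exp (max z.re 0)) (fun w _ => Complex.differentiableAt_exp)
      (fun w hw => by
        rw [Complex.deriv_exp, Complex.norm_exp]
        exact Real.exp_le_exp.2 hw)
      (show (0 : ℂ) ∈ {c : ℂ | c.re ≤ max z.re 0} from le_max_right z.re 0)
      (show z ∈ {c : ℂ | c.re ≤ max z.re 0} from le_max_left z.re 0)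
    rw [← sub_smul_dslope, norm_smul, sub_zero, mul_comm] at h
    exact le_of_mul_le_mul_right h (norm_pos_iff.2 hz)

theorem continuous_dslope_exp : Continuous (dslope Complex.exp 0) :=
  continuous_iff_continuousAt.2 fun z => by
    rcases eq_or_ne z 0 with rfl | hz
    · exact continuousAt_dslope_same.2 Complex.differentiableAt_exp
    · exact (continuousAt_dslope_of_ne hz).2 Complex.continuous_exp.continuousAt

/-- Currying a jointly continuous function gives convergence uniform on compact discs. -/
theorem tendstoUniformlyOn_comp_mul {g : ℂ → ℂ} (hg : Continuous g) (s : Set ℂ) (t₀ : ℝ≥0) (N : ℝ) :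
    TendstoUniformlyOn (fun t : ℝ≥0 => s.indicator fun z => g ((t : ℝ) * z))
      (s.indicator fun z => g ((t₀ : ℝ) * z)) (𝓝 t₀) {z | ‖z‖ ≤ N} := by
  let Φ : C(ℝ≥0 × ℂ, ℂ) := ⟨fun p => g ((p.1 : ℝ) * p.2), by fun_prop⟩
  have hK : IsCompact {z : ℂ | ‖z‖ ≤ N} := by
    simpa [Metric.closedBall, dist_zero_right] using isCompact_closedBall (0 : ℂ) N
  have h := ContinuousMap.tendsto_iff_forall_isCompact_tendstoUniformlyOn.1
    (Φ.curry.continuous.tendsto t₀) _ hK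
  rw [Metric.tendstoUniformlyOn_iff] at h ⊢
  intro ε hε
  filter_upwards [h ε hε] with t ht z hz
  by_cases hzs : z ∈ s
  · rw [Set.indicator_of_mem hzs, Set.indicator_of_mem hzs]
    exact ht z hz
  · simpa only [Set.indicator_of_notMem hzs, dist_self] using hε

variable [CompleteSpace X]

namespace SpectralMeasure

variable (E : SpectralMeasure X) {s : Set ℂ} {ω : ℝ}

/-- One bound serves all t in [0, b]; |ω| allows for negative ω. -/
theorem norm_indicator_exp_le (hω : s ⊆ {z : ℂ | z.re ≤ ω}) {t b : ℝ} (ht : 0 ≤ t) (htb : t ≤ b)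
    (z : ℂ) : ‖s.indicator (fun z => Complex.exp (t * z)) z‖ ≤ Real.exp (b * |ω|) := by
  by_cases hz : z ∈ s
  · rw [Set.indicator_of_mem hz, Complex.norm_exp, Complex.re_ofReal_mul]
    refine Real.exp_le_exp.2 ?_
    calc t * z.re ≤ t * |ω| := mul_le_mul_of_nonneg_left ((hω hz).trans (le_abs_self ω)) ht
      _ ≤ b * |ω| := mul_le_mul_of_nonneg_right htb (abs_nonneg ω)
  · rw [Set.indicator_of_notMem hz, norm_zero]
    positivity

theorem isBoundedBorel_indicator_exp (hs : MeasurableSet s) (hω : s ⊆ {z : ℂ | z.re ≤ ω}) {t : ℝ}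
    (ht : 0 ≤ t) : IsBoundedBorel (s.indicator fun z => Complex.exp (t * z)) :=
  ⟨Measurable.indicator (by fun_prop) hs, _, norm_indicator_exp_le hω ht le_rfl⟩

/-- The semigroup `t ↦ ∫ e ^ (t z) dE(z)` over a set of full spectral measure in a left
half-plane. -/
def expSemigroup (hs : MeasurableSet s) (h1 : E.proj s = 1) (hω : s ⊆ {z : ℂ | z.re ≤ ω}) :
    C0Semigroup X where
  op t := E.boundedIntegral (s.indicator fun z => Complex.exp ((t : ℝ) * z))
  op_zero := by
    rw [← h1, ← E.boundedIntegral_indicator_one hs]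
    congr 2
    ext z; simp
  op_add t u := by
    rw [← E.boundedIntegral_mul (isBoundedBorel_indicator_exp hs hω t.coe_nonneg)
      (isBoundedBorel_indicator_exp hs hω u.coe_nonneg)]
    congr 1
    ext z
    by_cases hz : z ∈ s
    · simp [hz, ← Complex.exp_add, add_mul]
    · simp [hz]
  continuous_orbit x := by
    refine continuous_iff_continuousAt.2 fun t₀ => ?_
    refine E.tendsto_boundedIntegral_apply (C := Real.exp ((t₀ + 1) * |ω|))
      (fun t => (isBoundedBorel_indicator_exp hs hω t.coe_nonneg).1)
      (isBoundedBorel_indicator_exp hs hω t₀.coe_nonneg).1 ?_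
      (norm_indicator_exp_le hω t₀.coe_nonneg (by simp))
      (fun N => tendstoUniformlyOn_comp_mul Complex.continuous_exp s t₀ N) x
    filter_upwards [eventually_le_nhds (show t₀ < t₀ + 1 by simp)] with t ht
    exact norm_indicator_exp_le hω t.coe_nonneg (by exact_mod_cast ht)

variable (hs : MeasurableSet s) (h1 : E.proj s = 1) (hω : s ⊆ {z : ℂ | z.re ≤ ω})

/-- Since (e^{tz} - 1)/t = ψ(tz)z, the quotient at `x` is the integral of the bounded function ψ(tz)
applied to `y`. As ψ(0) = 1, bounded convergence gives the limit `y`. -/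
theorem tendsto_expSemigroup_of_mem_graph {x y : X}
    (h : (x, y) ∈ (E.integral fun z => z).graph) :
    Tendsto (fun t : ℝ≥0 => (((t : ℝ) : ℂ)⁻¹ • ((E.expSemigroup hs h1 hω).op t - 1)) x)
      (𝓝[>] 0) (𝓝 y) := by
  have hψm (t : ℝ≥0) :
      Measurable (s.indicator fun z : ℂ => dslope Complex.exp 0 ((t : ℝ) * z)) :=
    (continuous_dslope_exp.measurable.comp (by fun_prop)).indicator hs
  have hψ {t : ℝ≥0} (ht : t ≤ 1) (z : ℂ) :
      ‖s.indicator (fun z : ℂ => dslope Complex.exp 0 ((t : ℝ) * z)) z‖ ≤ Real.exp |ω| := by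
    by_cases hz : z ∈ s
    · rw [Set.indicator_of_mem hz]
      refine (norm_dslope_exp_le _).trans (Real.exp_le_exp.2 (max_le ?_ (abs_nonneg ω)))
      rw [Complex.re_ofReal_mul]
      calc t * z.re ≤ t * |ω| := mul_le_mul_of_nonneg_left ((hω hz).trans (le_abs_self ω)) t.coe_nonneg
        _ ≤ |ω| := mul_le_of_le_one_left (abs_nonneg ω) (by exact_mod_cast ht)
    · rw [Set.indicator_of_notMem hz, norm_zero]
      positivity
  have hlim := E.tendsto_boundedIntegral_apply (l := 𝓝 (0 : ℝ≥0)) hψm (hψm 0)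
    ((eventually_le_nhds one_pos).mono fun t ht => hψ ht) (hψ zero_le_one)
    (fun N => tendstoUniformlyOn_comp_mul continuous_dslope_exp s 0 N) y
  have h0 : (s.indicator fun z : ℂ => dslope Complex.exp 0 (((0 : ℝ≥0) : ℝ) * z)) =
      s.indicator 1 := by
    ext z; simp [dslope_same, Pi.one_def]
  rw [h0, E.boundedIntegral_indicator_one hs, h1] at hlim
  refine (hlim.mono_left nhdsWithin_le_nhds).congr' ?_
  filter_upwards [eventually_mem_nhdsWithin,
    mem_nhdsWithin_of_mem_nhds (eventually_le_nhds (one_pos (α := ℝ≥0)))] with t ht ht1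
  have hT := isBoundedBorel_indicator_exp hs hω t.coe_nonneg
  have hone : IsBoundedBorel (s.indicator 1) := .indicator_one hs
  have e : ((s.indicator fun z : ℂ => dslope Complex.exp 0 ((t : ℝ) * z)) * fun z => z) =
      (((t : ℝ) : ℂ)⁻¹) • ((s.indicator fun z => Complex.exp ((t : ℝ) * z)) - s.indicator 1) := by
    ext z
    have ht0 : ((t : ℝ) : ℂ) ≠ 0 := by exact_mod_cast (ne_of_gt ht)
    have hd := sub_smul_dslope Complex.exp 0 ((t : ℝ) * z)
    rw [Complex.exp_zero, sub_zero, smul_eq_mul] at hd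
    by_cases hz : z ∈ s
    · simp only [Pi.mul_apply, Pi.smul_apply, Pi.sub_apply, Set.indicator_of_mem hz, Pi.one_apply,
        smul_eq_mul, ← hd]
      field_simp
    · simp [hz]
  have key := E.boundedIntegral_apply_of_mem_graph measurable_id' ⟨hψm t, _, hψ ht1⟩
    (e ▸ (hT.sub hone).const_smul _) h
  rw [key, e, E.boundedIntegral_smul _ (hT.sub hone), E.boundedIntegral_sub hT hone,
    E.boundedIntegral_indicator_one hs, h1]
  rfl

/-- For the converse inclusion, the projection to a disc commutes with the semigroup and sends `x`
into the domain of the integral, so the known limit there identifies the projection of `y`. -/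
theorem generator_expSemigroup :
    (E.expSemigroup hs h1 hω).generator = E.integral fun z => z := by
  refine eq_of_mem_graph_iff fun x y => ?_
  rw [C0Semigroup.generator, mem_graph_strongLimit]
  refine ⟨fun h => ?_, E.tendsto_expSemigroup_of_mem_graph hs h1 hω⟩
  refine E.mem_graph_of_forall_proj measurable_id' fun n => ?_
  have hS : MeasurableSet {z : ℂ | ‖z‖ ≤ n} := measurableSet_le measurable_norm measurable_const
  refine tendsto_nhds_unique (((E.proj {z | ‖z‖ ≤ n}).continuous.tendsto y).comp h) ?_
  refine (E.tendsto_expSemigroup_of_mem_graph hs h1 hω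
    (E.mem_graph_proj measurable_id' hS (.truncation measurable_id' n) x)).congr fun t => ?_
  have hc : (E.expSemigroup hs h1 hω).op t (E.proj {z | ‖z‖ ≤ n} x) =
      E.proj {z | ‖z‖ ≤ n} ((E.expSemigroup hs h1 hω).op t x) := by
    rw [← E.boundedIntegral_indicator_one hS]
    exact E.boundedIntegral_comm (isBoundedBorel_indicator_exp hs hω t.coe_nonneg) (.indicator_one hS) x
  simp [hc]

end SpectralMeasure

end ScalarSpectral

end

theorem theorem3p1 {X : Type*} [NormedAddCommGroup X] [NormedSpace ℂ X] [CompleteSpace X]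
    (A : X →ₗ.[ℂ] X) (E : ScalarSpectral.SpectralMeasure X)
    (hA : ScalarSpectral.IsScalarTypeSpectral A E) :
    -- `A` is not hypercyclic: each orbit of a nonzero vector is bounded away from `0` or bounded
    ¬ ScalarSpectral.IsHypercyclic A ∧
    (∀ (f : X) (hf : ∀ n, f ∈ (ScalarSpectral.opPow A n).domain), f ≠ 0 →
      (∃ c : ℝ, 0 < c ∧ ∀ n, c ≤ ‖ScalarSpectral.opPow A n ⟨f, hf n⟩‖) ∨
      (∃ C : ℝ, ∀ n, ‖ScalarSpectral.opPow A n ⟨f, hf n⟩‖ ≤ C)) ∧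
    -- the same for the exponentials
    ¬ ScalarSpectral.IsHypercyclicFamily (fun t : ℝ≥0 => ScalarSpectral.opExp A E t) ∧
    (∀ (f : X) (hf : ∀ t : ℝ≥0, f ∈ (ScalarSpectral.opExp A E t).domain), f ≠ 0 →
      (∃ c : ℝ, 0 < c ∧ ∀ t : ℝ≥0, c ≤ ‖ScalarSpectral.opExp A E t ⟨f, hf t⟩‖) ∨
      (∃ C : ℝ, ∀ t : ℝ≥0, ‖ScalarSpectral.opExp A E t ⟨f, hf t⟩‖ ≤ C)) ∧
    -- if the spectrum lies in a left half-plane, the exponentials are everywhere defined and form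
    -- the `C₀`-semigroup generated by `A`
    (∀ ω : ℝ, ScalarSpectral.opSpectrum A ⊆ {z : ℂ | z.re ≤ ω} →
      ∃ T : ScalarSpectral.C0Semigroup X, T.generator = A ∧
        ∀ t : ℝ≥0, ScalarSpectral.opExp A E t = (T.op t : X →ₗ[ℂ] X).toPMap ⊤) := by
  refine ⟨ScalarSpectral.not_isHypercyclicFamily _ fun f hf _ => hA.opPow_dichotomy f hf,
    fun f hf _ => hA.opPow_dichotomy f hf,
    ScalarSpectral.not_isHypercyclicFamily _ fun f hf _ => ScalarSpectral.opExp_dichotomy A E f hf,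
    fun f hf _ => ScalarSpectral.opExp_dichotomy A E f hf, fun ω hω => ?_⟩
  have hs := (ScalarSpectral.isClosed_opSpectrum A).measurableSet
  refine ⟨E.expSemigroup hs hA.proj_opSpectrum hω,
    (E.generator_expSemigroup hs hA.proj_opSpectrum hω).trans (Eq.symm hA), fun t => ?_⟩
  refine ScalarSpectral.eq_of_mem_graph_iff fun x y => ?_
  rw [ScalarSpectral.mem_graph_toPMap_top]
  exact E.mem_graph_integral_of_bounded
    (ScalarSpectral.SpectralMeasure.isBoundedBorel_indicator_exp hs hω t.coe_nonneg)
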